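/- Let $n\ge 3$, let $[a,b]\subset\mathbb R$ be a compact interval with $a<b$, and let $F:[a,b]\to\mathbb R^n$ be a nonconstant Lipschitz map whose image $\Gamma_F=F([a,b])$ is Lipschitz triangulable. This means that $\Gamma_F$ is a union of finitely many arcs $\gamma_i$ such that for $i\ne j$ the intersection $\gamma_i\cap\gamma_j$ is either empty or consists of exactly one point, which is an endpoint of both arcs, and that each $\gamma_i$ is parameterized by an injective Lipschitz map $h_i$ of $[0,1]$ onto $\gamma_i$ whose inverse $h_i^{-1}:\gamma_i\to[0,1]$ is locally Lipschitz away from the endpoints of $\gamma_i$. Let $\mathcal G_F$ be the set of Lipschitz maps $G=(g_1,\dots,g_n):[a,b]\to\mathbb R^n$ with $G([a,b])\subset\Gamma_F$, and let $\mathcal H\subset\mathcal G_F$ be a subset all of whose elements are closed paths, i.e. $G(a)=G(b)$ for all $G\in\mathcal H$. A moment of $G$ of degree $d$ is an integral $\int_a^b g_1(t)^{d_1}\cdots g_n(t)^{d_n}\,g_i'(t)\,dt$ with $1\le i\le n$, integers $d_j\ge 0$ and $d_1+\dots+d_n=d$. Say that the Moments Finiteness Problem for $\mathcal H$ is solved by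 an integer $N\ge 0$ if for every $G\in\mathcal H$ all of whose moments of degrees $\le N$ vanish, all moments of $G$ vanish. For $v=(v_1,v_2)\in\mathbb R^n\times\mathbb R^n$ and $G\in\mathcal H$ put $G_v=(g_{1v},g_{2v}):=(\langle v_1,G\rangle,\langle v_2,G\rangle):[a,b]\to\mathbb R^2$, and $\mathcal H_v=\{G_v: G\in\mathcal H\}$. Say that the Restricted Moments Finiteness Problem for $\mathcal H_v$ is solved by an integer $N_v\ge 0$ if for every $G_v\in\mathcal H_v$ such that $\int_a^b g_{1v}'(t)\,dt=0$ and $\int_a^b g_{1v}(t)^d\,g_{2v}'(t)\,dt=0$ for all integers $0\le d\le N_v$, one has $\int_a^b g_{1v}(t)^d\,g_{2v}'(t)\,dt=0$ for all integers $d\ge 0$. Theorem. For almost every $v\in\mathbb R^n\times\mathbb R^n$ (with respect to Lebesgue measure), the Moments Finiteness Problem for $\mathcal H$ is solved by some integer $N\ge 0$ if and only if the Restricted Moments Finiteness Problem for $\mathcal H_v$ is solved by some integer $N_v\ge 0$, and the optimal (least) constants $N$ and $N_v$ in the two problems coincide. -/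

import Mathlib

open MeasureTheory Set

noncomputable section

/-- A Lipschitz map `[a,b] → E`. A map on `[a,b]` is represented by a function on `ℝ`, of which
only the values on `[a,b]` are ever used. -/
def IsLipschitzPath {E : Type*} [PseudoEMetricSpace E] (a b : ℝ) (G : ℝ → E) : Prop :=
  ∃ K : NNReal, LipschitzOnWith K G (Icc a b)

/-- `h : [0,1] → E` is a Lipschitz parameterization of the arc `h([0,1])`: it has an inverse `g` on
this arc (so that `h` is injective on `[0,1]`), and `g` is locally Lipschitz on the arc without
its endpoints. -/
def IsLipschitzArc {E : Type*} [PseudoEMetricSpace E] (h : ℝ → E) : Prop :=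
  IsLipschitzPath 0 1 h ∧
    ∃ g : E → ℝ, LeftInvOn g h (Icc 0 1) ∧ LocallyLipschitzOn (h '' Ioo 0 1) g

/-- A Lipschitz triangulable curve: a finite union of Lipschitz arcs such that any two distinct
ones are disjoint or meet in exactly one point, which is an endpoint of both. -/
def IsLipschitzTriangulable {E : Type*} [PseudoEMetricSpace E] (S : Set E) : Prop :=
  ∃ (m : ℕ) (h : Fin m → ℝ → E),
    (∀ i, IsLipschitzArc (h i)) ∧
    S = ⋃ i, h i '' Icc 0 1 ∧
    ∀ i j, i ≠ j →
      (h i '' Icc 0 1 ∩ h j '' Icc 0 1).Subsingleton ∧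
      h i '' Icc 0 1 ∩ h j '' Icc 0 1 ⊆ {h i 0, h i 1} ∩ {h j 0, h j 1}

/-- The set of Lipschitz maps `G : [a,b] → E` with `G([a,b]) ⊆ F([a,b])`. -/
def lipschitzMapsInto {E : Type*} [PseudoEMetricSpace E] (a b : ℝ) (F : ℝ → E) : Set (ℝ → E) :=
  {G | IsLipschitzPath a b G ∧ G '' Icc a b ⊆ F '' Icc a b}

/-- The moment `∫_a^b g₁(t)^{d₁} ⋯ gₙ(t)^{dₙ} gᵢ'(t) dt`; its degree is `∑ j, d j`. -/
def moment {n : ℕ} (a b : ℝ) (G : ℝ → EuclideanSpace ℝ (Fin n)) (d : Fin n → ℕ) (i : Fin n) : ℝ :=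
  ∫ t in a..b, (∏ j, G t j ^ d j) * deriv (fun s => G s i) t

/-- `N` answers the Moments Finiteness Problem for `H`: if all moments of degrees `≤ N` of some
`G ∈ H` vanish, then all moments of `G` vanish. -/
def MomentsFiniteness {n : ℕ} (a b : ℝ) (H : Set (ℝ → EuclideanSpace ℝ (Fin n))) (N : ℕ) : Prop :=
  ∀ G ∈ H, (∀ (d : Fin n → ℕ) (i : Fin n), ∑ j, d j ≤ N → moment a b G d i = 0) →
    ∀ (d : Fin n → ℕ) (i : Fin n), moment a b G d i = 0

/-- The planar map `G_v : t ↦ (⟨v₁, G t⟩, ⟨v₂, G t⟩)`. -/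
def planarProj {n : ℕ} (v : EuclideanSpace ℝ (Fin n) × EuclideanSpace ℝ (Fin n))
    (G : ℝ → EuclideanSpace ℝ (Fin n)) : ℝ → EuclideanSpace ℝ (Fin 2) :=
  fun t => !₂[inner ℝ v.1 (G t), inner ℝ v.2 (G t)]

/-- `N` answers the Restricted Moments Finiteness Problem for a set `P` of planar maps: if for some
`g = (g₁, g₂) ∈ P` the moments `∫_a^b g₁'` and `∫_a^b g₁^d g₂'`, `d ≤ N`, vanish, then
`∫_a^b g₁^d g₂'` vanishes for all `d`. -/
def RestrictedMomentsFiniteness (a b : ℝ) (P : Set (ℝ → EuclideanSpace ℝ (Fin 2))) (N : ℕ) :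
    Prop :=
  ∀ g ∈ P, (∫ t in a..b, deriv (fun s => g s 0) t) = 0 →
    (∀ d ≤ N, (∫ t in a..b, g t 0 ^ d * deriv (fun s => g s 1) t) = 0) →
    ∀ d : ℕ, (∫ t in a..b, g t 0 ^ d * deriv (fun s => g s 1) t) = 0

end

open Filter Topology Asymptotics

/-! The degree `d` restricted moment of `G_v` is a form in `v` whose coefficients are positive
multiples of the degree `d` moments of `G` (`IsLipschitzPath.integral_planarProj`). If one of these
is nonzero, the form is a nonzero homogeneous polynomial, so it vanishes only on a null set of `v`
(`ae_momentForm_ne_zero`). This null set depends on `G`, and there may be uncountably many `G`.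

What saves the argument is that moments of closed paths in a triangulable curve take only countably
many values: along each arc a form `p dℓ` has a primitive, and the integral over a closed path lies
in the group generated by the finitely many values of these primitives at end points of arcs
(`IsLipschitzPath.lineIntegral_mem_closure`). So countably many null sets suffice, and off their
union a restricted moment of degree `d` vanishes exactly when all moments of degree `d` do. Then the
same `N` solve both problems. -/

/-- The integral over `[s, t]` of the pullback under `G` of the `1`-form `p dℓ`. -/
noncomputable def lineIntegral {E : Type*} [NormedAddCommGroup E] [NormedSpace ℝ E] (p : E → ℝ)
    (ℓ : E →L[ℝ] ℝ) (G : ℝ → E) (s t : ℝ) : ℝ :=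
  ∫ τ in s..t, p (G τ) * deriv (fun σ => ℓ (G σ)) τ

theorem IsLipschitzPath.continuousOn {E : Type*} [PseudoEMetricSpace E] {a b : ℝ} {G : ℝ → E}
    (hG : IsLipschitzPath a b G) : ContinuousOn G (Icc a b) :=
  let ⟨_, h⟩ := hG
  h.continuousOn

/-! ### Line integrals along Lipschitz paths. -/

section LineIntegral

variable {E : Type*} [NormedAddCommGroup E] [NormedSpace ℝ E] {p : E → ℝ} {ℓ : E →L[ℝ] ℝ}
  {G : ℝ → E} {a b s t u : ℝ}

theorem IsLipschitzPath.clm_comp (hG : IsLipschitzPath a b G) (ℓ : E →L[ℝ] ℝ) :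
    IsLipschitzPath a b fun σ => ℓ (G σ) :=
  let ⟨_, h⟩ := hG
  ⟨_, ℓ.lipschitz.comp_lipschitzOnWith h⟩

theorem IsLipschitzPath.absolutelyContinuousOnInterval {f : ℝ → ℝ} (hf : IsLipschitzPath a b f)
    (hs : s ∈ Icc a b) (ht : t ∈ Icc a b) : AbsolutelyContinuousOnInterval f s t :=
  let ⟨_, h⟩ := hf
  (h.mono (uIcc_subset_Icc hs ht)).absolutelyContinuousOnInterval

theorem IsLipschitzPath.intervalIntegrable_mul_deriv {f q : ℝ → ℝ} (hq : IsLipschitzPath a b q)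
    (hf : ContinuousOn f (Icc a b)) (hs : s ∈ Icc a b) (ht : t ∈ Icc a b) :
    IntervalIntegrable (fun τ => f τ * deriv q τ) volume s t :=
  (hq.absolutelyContinuousOnInterval hs ht).intervalIntegrable_deriv.continuousOn_mul
    (hf.mono (uIcc_subset_Icc hs ht))

theorem IsLipschitzPath.lineIntegral_add (hG : IsLipschitzPath a b G) (hp : Continuous p)
    (hs : s ∈ Icc a b) (ht : t ∈ Icc a b) (hu : u ∈ Icc a b) :
    lineIntegral p ℓ G s t + lineIntegral p ℓ G t u = lineIntegral p ℓ G s u :=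
  intervalIntegral.integral_add_adjacent_intervals
    ((hG.clm_comp ℓ).intervalIntegrable_mul_deriv (hp.comp_continuousOn hG.continuousOn) hs ht)
    ((hG.clm_comp ℓ).intervalIntegrable_mul_deriv (hp.comp_continuousOn hG.continuousOn) ht hu)

theorem IsLipschitzPath.ae_norm_deriv_le {f : ℝ → ℝ} (hf : IsLipschitzPath a b f) :
    ∃ K : ℝ, 0 < K ∧ ∀ᵐ τ, τ ∈ Icc a b → ‖deriv f τ‖ ≤ K := by
  obtain ⟨K, hK⟩ := hf
  -- `K` may be zero, while the bound is later used as a divisor.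
  refine ⟨K + 1, by positivity, ?_⟩
  have h1 : ∀ c : ℝ, ∀ᵐ τ : ℝ, τ ≠ c := fun c => by simp [ae_iff]
  filter_upwards [h1 a, h1 b] with τ ha hb hτ
  have := norm_deriv_le_of_lipschitzOn
    (Icc_mem_nhds (lt_of_le_of_ne hτ.1 ha.symm) (lt_of_le_of_ne hτ.2 hb)) hK
  linarith

/-- To first order, `∫_s^t p dℓ` is `p(G(s)) (ℓ(G(t)) - ℓ(G(s)))`. -/
theorem IsLipschitzPath.lineIntegral_sub_isLittleO (hG : IsLipschitzPath a b G)
    (hp : Continuous p) (hs : s ∈ Icc a b) :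
    (fun t => lineIntegral p ℓ G s t - p (G s) * (ℓ (G t) - ℓ (G s)))
      =o[𝓝[Icc a b] s] fun t => t - s := by
  have hq := hG.clm_comp ℓ
  have hpG : ContinuousOn (fun τ => p (G τ)) (Icc a b) := hp.comp_continuousOn hG.continuousOn
  obtain ⟨K, hK0, hK⟩ := hq.ae_norm_deriv_le
  rw [isLittleO_iff]
  intro c hc
  have hcont := hpG s hs
  have hev := Metric.continuousWithinAt_iff.1 hcont (c / K) (by positivity)
  obtain ⟨δ, hδ, hev⟩ := hev
  filter_upwards [self_mem_nhdsWithin, mem_nhdsWithin_of_mem_nhds (Metric.ball_mem_nhds s hδ)]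
    with t ht htδ
  have hsub : uIoc s t ⊆ Icc a b := uIoc_subset_uIcc.trans (uIcc_subset_Icc hs ht)
  have hball : uIoc s t ⊆ Metric.ball s δ :=
    uIoc_subset_uIcc.trans
      ((convex_ball s δ).ordConnected.uIcc_subset (Metric.mem_ball_self hδ) htδ)
  have hint := hq.intervalIntegrable_mul_deriv hpG hs ht
  have hint' := hq.intervalIntegrable_mul_deriv (f := fun _ => p (G s)) continuousOn_const hs ht
  have heq : lineIntegral p ℓ G s t - p (G s) * (ℓ (G t) - ℓ (G s))
      = ∫ τ in s..t, (p (G τ) - p (G s)) * deriv (fun σ => ℓ (G σ)) τ := by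
    rw [← (hq.absolutelyContinuousOnInterval hs ht).integral_deriv_eq_sub,
      ← intervalIntegral.integral_const_mul, lineIntegral,
      ← intervalIntegral.integral_sub hint hint']
    simp only [sub_mul]
  rw [heq, Real.norm_eq_abs (t - s)]
  refine intervalIntegral.norm_integral_le_of_norm_le_const_ae ?_
  filter_upwards [hK] with τ hτ hτs
  rw [norm_mul]
  have h1 := hτ (hsub hτs)
  have h2 := hev (hsub hτs) (hball hτs)
  rw [dist_eq_norm] at h2
  calc _ ≤ c / K * K := by gcongr
    _ = c := by field_simp

end LineIntegral

/-- A continuous function on a connected set of reals, covered by countably many sets within each of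
which its derivative vanishes, is constant: its image is a connected null set. -/
theorem eq_of_hasDerivWithinAt_zero_iUnion {ι : Type*} [Countable ι] {D : ℝ → ℝ} {S : Set ℝ}
    (hS : IsPreconnected S) (hD : ContinuousOn D S) {A : ι → Set ℝ} (hA : S ⊆ ⋃ k, A k)
    (hDA : ∀ k, ∀ x ∈ A k, HasDerivWithinAt D 0 (A k) x) {x y : ℝ} (hx : x ∈ S) (hy : y ∈ S) :
    D x = D y := by
  have hnull : volume (D '' S) = 0 := by
    refine measure_mono_null (image_mono hA) ?_
    rw [image_iUnion, measure_iUnion_null_iff]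
    intro k
    refine addHaar_image_eq_zero_of_det_fderivWithin_eq_zero volume
      (f' := fun _ => 0) (fun x hx => ?_) (by simp)
    simpa using (hDA k x hx).hasFDerivWithinAt
  have hconn := (hS.image D hD).ordConnected
  by_contra hne
  have hsub := hconn.uIcc_subset (mem_image_of_mem D hx) (mem_image_of_mem D hy)
  have := measure_mono_null hsub hnull
  rw [Real.volume_interval, ENNReal.ofReal_eq_zero] at this
  exact hne (sub_eq_zero.1 (abs_eq_zero.1 (le_antisymm this (abs_nonneg _)))).symm

/-! ### Primitives along a single arc. -/

section Arc

variable {E : Type*} [NormedAddCommGroup E] [NormedSpace ℝ E] {p : E → ℝ} {ℓ : E →L[ℝ] ℝ}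
  {G : ℝ → E} {a b : ℝ}

/-- A continuous map sends closed subsets of a compact set to compact, hence closed, sets. This
gives continuity of the inverse of an arc up to its end points, where no Lipschitz bound is assumed.
-/
theorem ContinuousOn.continuousOn_image_of_leftInvOn {X Y : Type*} [TopologicalSpace X]
    [TopologicalSpace Y] [T2Space Y] {h : X → Y} {g : Y → X} {K : Set X} (hK : IsCompact K)
    (hh : ContinuousOn h K) (hg : LeftInvOn g h K) : ContinuousOn g (h '' K) := by
  rw [continuousOn_iff_isClosed]
  intro C hC
  refine ⟨h '' (K ∩ C), ((hK.inter_right hC).image_of_continuousOn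
    (hh.mono inter_subset_left)).isClosed, ?_⟩
  ext y
  constructor
  · rintro ⟨hy, x, hx, rfl⟩
    rw [mem_preimage, hg hx] at hy
    exact ⟨⟨x, ⟨hx, hy⟩, rfl⟩, ⟨x, hx, rfl⟩⟩
  · rintro ⟨⟨x, ⟨hx, hxC⟩, rfl⟩, -⟩
    refine ⟨?_, ⟨x, hx, rfl⟩⟩
    rwa [mem_preimage, hg hx]

theorem IsLipschitzPath.continuousOn_lineIntegral (hG : IsLipschitzPath a b G)
    (hp : Continuous p) : ContinuousOn (lineIntegral p ℓ G a) (Icc a b) := by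
  rcases lt_or_ge b a with hab | hab
  · simp [Icc_eq_empty_of_lt hab]
  · rw [← uIcc_of_le hab]
    exact (((hG.clm_comp ℓ).intervalIntegrable_mul_deriv (hp.comp_continuousOn hG.continuousOn)
      (left_mem_Icc.2 hab)
      (right_mem_Icc.2 hab)).absolutelyContinuousOnInterval_intervalIntegral
        left_mem_uIcc).continuousOn

/-- The line integral along the arc `h` from `h 0` to `x`, where `g` is the inverse of `h`. -/
noncomputable def arcPrimitive (p : E → ℝ) (ℓ : E →L[ℝ] ℝ) (h : ℝ → E) (g : E → ℝ) (x : E) : ℝ :=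
  lineIntegral p ℓ h 0 (g x)

theorem IsLipschitzPath.continuousOn_arcPrimitive {h : ℝ → E} {g : E → ℝ}
    (hh : IsLipschitzPath 0 1 h) (hg : LeftInvOn g h (Icc 0 1)) (hp : Continuous p) :
    ContinuousOn (arcPrimitive p ℓ h g) (h '' Icc 0 1) :=
  (hh.continuousOn_lineIntegral hp).comp
    (hh.continuousOn.continuousOn_image_of_leftInvOn isCompact_Icc hg)
    (by rintro _ ⟨x, hx, rfl⟩; rwa [hg hx])

/-- Inside an arc, the primitive along the arc and the line integral of a path have the same
derivative. -/
theorem IsLipschitzPath.hasDerivWithinAt_arcPrimitive_sub {h : ℝ → E} {g : E → ℝ}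
    (hG : IsLipschitzPath a b G) (hh : IsLipschitzPath 0 1 h) (hg : LeftInvOn g h (Icc 0 1))
    (hg' : LocallyLipschitzOn (h '' Ioo 0 1) g) (hp : Continuous p) {A : Set ℝ}
    (hA : A ⊆ Icc a b) (hGA : MapsTo G A (h '' Ioo 0 1)) {x : ℝ} (hx : x ∈ A) :
    HasDerivWithinAt (fun t => arcPrimitive p ℓ h g (G t) - lineIntegral p ℓ G a t) 0 A x := by
  have hu : ∀ t ∈ A, g (G t) ∈ Icc (0 : ℝ) 1 ∧ h (g (G t)) = G t := by
    intro t ht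
    obtain ⟨r, hr, hrt⟩ := hGA ht
    rw [← hrt, hg (Ioo_subset_Icc_self hr)]
    exact ⟨Ioo_subset_Icc_self hr, rfl⟩
  have hGc : Tendsto G (𝓝[A] x) (𝓝[h '' Ioo 0 1] (G x)) :=
    tendsto_nhdsWithin_iff.2 ⟨(hG.continuousOn x (hA hx)).mono hA,
      eventually_mem_nhdsWithin.mono fun t ht => hGA ht⟩
  obtain ⟨K, T, hT, hK⟩ := hg' (hGA hx)
  obtain ⟨L, hL⟩ := hG
  -- Near `G x` the inverse `g` is Lipschitz, so errors that are small compared with the arc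
  -- parameter are small compared with `t - x`.
  have hbig : (fun t => g (G t) - g (G x)) =O[𝓝[A] x] fun t => t - x := by
    refine IsBigO.of_bound (K * L) ?_
    filter_upwards [hGc hT, self_mem_nhdsWithin] with t ht htA
    have h1 := hK.dist_le_mul (G t) ht (G x) (mem_of_mem_nhdsWithin (hGA hx) hT)
    have h2 := hL.dist_le_mul t (hA htA) x (hA hx)
    rw [dist_eq_norm, dist_eq_norm] at h1
    rw [dist_eq_norm, dist_eq_norm] at h2
    calc _ ≤ _ := h1
      _ ≤ K * (L * ‖t - x‖) := by gcongr
      _ = _ := by ring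
  have hG : IsLipschitzPath a b G := ⟨L, hL⟩
  have hgc : Tendsto (fun t => g (G t)) (𝓝[A] x) (𝓝[Icc 0 1] (g (G x))) := by
    refine tendsto_nhdsWithin_iff.2 ⟨?_, eventually_mem_nhdsWithin.mono fun t ht => (hu t ht).1⟩
    exact (hg'.continuousOn _ (hGA hx)).tendsto.comp hGc
  have ho1 := ((hh.lineIntegral_sub_isLittleO (ℓ := ℓ) hp (hu x hx).1).comp_tendsto
    hgc).trans_isBigO hbig
  have ho2 := (hG.lineIntegral_sub_isLittleO (ℓ := ℓ) hp (hA hx)).mono (nhdsWithin_mono x hA)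
  rw [hasDerivWithinAt_iff_isLittleO]
  -- Both increments have the same leading term `p (G x) * (ℓ (G t) - ℓ (G x))`, because `h (g (G
  -- t)) = G t`.
  refine (ho1.sub ho2).congr' ?_ EventuallyEq.rfl
  filter_upwards [self_mem_nhdsWithin] with t ht
  have hab : a ∈ Icc a b := ⟨le_rfl, (hA hx).1.trans (hA hx).2⟩
  have e1 := hG.lineIntegral_add (ℓ := ℓ) hp hab (hA hx) (hA ht)
  have e2 := hh.lineIntegral_add (ℓ := ℓ) hp (left_mem_Icc.2 zero_le_one) (hu x hx).1 (hu t ht).1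
  simp only [Function.comp, (hu x hx).2, (hu t ht).2, arcPrimitive, smul_zero]
  rw [← e1, ← e2]
  ring

/-- On a level set of a path, its line integral has derivative zero. -/
theorem IsLipschitzPath.hasDerivWithinAt_lineIntegral_of_const (hG : IsLipschitzPath a b G)
    (hp : Continuous p) {A : Set ℝ} (hA : A ⊆ Icc a b) {w : E} (hGA : ∀ t ∈ A, G t = w) {x : ℝ}
    (hx : x ∈ A) : HasDerivWithinAt (lineIntegral p ℓ G a) 0 A x := by
  have ho := (hG.lineIntegral_sub_isLittleO (ℓ := ℓ) hp (hA hx)).mono (nhdsWithin_mono x hA)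
  rw [hasDerivWithinAt_iff_isLittleO]
  refine ho.congr' ?_ EventuallyEq.rfl
  filter_upwards [self_mem_nhdsWithin] with t ht
  have hab : a ∈ Icc a b := ⟨le_rfl, (hA hx).1.trans (hA hx).2⟩
  have e1 := hG.lineIntegral_add (ℓ := ℓ) hp hab (hA hx) (hA ht)
  rw [hGA x hx, hGA t ht, ← e1]
  simp

end Arc

/-! ### Vertices, and periods on a triangulated curve. -/

/-- The set of end points of a family of arcs. -/
def arcVertices {E ι : Type*} (h : ι → ℝ → E) : Set E :=
  ⋃ i, {h i 0, h i 1}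

theorem mem_endpoints_of_mem_arcVertices {E ι : Type*} {h : ι → ℝ → E}
    (hc : ∀ i j, i ≠ j → h i '' Icc 0 1 ∩ h j '' Icc 0 1 ⊆ {h i 0, h i 1} ∩ {h j 0, h j 1})
    {x : E} (hx : x ∈ arcVertices h) {i : ι} (hi : x ∈ h i '' Icc 0 1) :
    x = h i 0 ∨ x = h i 1 := by
  obtain ⟨j, hj⟩ := mem_iUnion.1 hx
  rcases eq_or_ne i j with rfl | hij
  · exact hj
  · refine (hc i j hij ⟨hi, ?_⟩).1
    rcases hj with rfl | rfl
    · exact mem_image_of_mem _ (by simp)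
    · exact mem_image_of_mem _ (by simp)

theorem mem_image_Ioo_of_notMem_arcVertices {E ι : Type*} {h : ι → ℝ → E} {x : E}
    (hx : x ∉ arcVertices h) {i : ι} (hi : x ∈ h i '' Icc 0 1) : x ∈ h i '' Ioo 0 1 := by
  obtain ⟨r, hr, rfl⟩ := hi
  refine mem_image_of_mem _ ⟨lt_of_le_of_ne hr.1 ?_, lt_of_le_of_ne hr.2 ?_⟩
  · rintro rfl
    exact hx (mem_iUnion.2 ⟨i, by simp⟩)
  · rintro rfl
    exact hx (mem_iUnion.2 ⟨i, by simp⟩)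

section Triangulation

variable {E : Type*} [NormedAddCommGroup E] [NormedSpace ℝ E] {p : E → ℝ} {ℓ : E →L[ℝ] ℝ}
  {G : ℝ → E} {a b : ℝ} {ι : Type*} {h : ι → ℝ → E} {g : ι → E → ℝ}

/-- While a path in a triangulated curve meets at most one vertex, its line integral is, up to
constants depending only on the arcs, the difference of the primitives along the arcs. -/
theorem IsLipschitzPath.exists_lineIntegral_eq [Finite ι] (hG : IsLipschitzPath a b G)
    (hh : ∀ i, IsLipschitzPath 0 1 (h i)) (hg : ∀ i, LeftInvOn (g i) (h i) (Icc 0 1))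
    (hg' : ∀ i, LocallyLipschitzOn (h i '' Ioo 0 1) (g i)) (hp : Continuous p)
    (hc : ∀ i j, i ≠ j → h i '' Icc 0 1 ∩ h j '' Icc 0 1 ⊆ {h i 0, h i 1} ∩ {h j 0, h j 1})
    {x y : ℝ} (hxy : uIcc x y ⊆ Icc a b) {w : E}
    (hw : ∀ t ∈ uIcc x y, G t ∈ arcVertices h → G t = w)
    {σ : E → ι} (hσ : ∀ t ∈ uIcc x y, G t ∈ h (σ (G t)) '' Icc 0 1) :
    ∃ c : ι → ℝ,
      (∀ i, c i = 0 ∨ w ∈ arcVertices h ∧ w ∈ h i '' Icc 0 1 ∧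
        c i = arcPrimitive p ℓ (h i) (g i) w) ∧
      lineIntegral p ℓ G x y =
        (arcPrimitive p ℓ (h (σ (G y))) (g (σ (G y))) (G y) - c (σ (G y))) -
          (arcPrimitive p ℓ (h (σ (G x))) (g (σ (G x))) (G x) - c (σ (G x))) := by
  classical
  let Φ : ι → E → ℝ := fun i => arcPrimitive p ℓ (h i) (g i)
  -- If `w` is a vertex, subtracting `c i` makes the primitives of all arcs through `w` vanish
  -- there, so they glue to one function `f` along the path.
  let c : ι → ℝ := fun i => if w ∈ arcVertices h ∧ w ∈ h i '' Icc 0 1 then Φ i w else 0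
  refine ⟨c, fun i => ?_, ?_⟩
  · by_cases hi : w ∈ arcVertices h ∧ w ∈ h i '' Icc 0 1
    · exact Or.inr ⟨hi.1, hi.2, if_pos hi⟩
    · exact Or.inl (if_neg hi)
  have hcw : ∀ i, w ∈ arcVertices h → w ∈ h i '' Icc 0 1 → Φ i w - c i = 0 := by
    intro i h1 h2
    simp only [c, if_pos (And.intro h1 h2), sub_self]
  let f : E → ℝ := fun z => Φ (σ z) z - c (σ z)
  have hf : ∀ t ∈ uIcc x y, ∀ i, G t ∈ h i '' Icc 0 1 → f (G t) = Φ i (G t) - c i := by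
    intro t ht i hi
    by_cases hti : σ (G t) = i
    · simp only [f, hti]
    · have hv : G t ∈ arcVertices h :=
        mem_iUnion.2 ⟨i, (hc _ i hti ⟨hσ t ht, hi⟩).2⟩
      have h1 := hσ t ht
      simp only [f]
      have hGt := hw t ht hv
      rw [hGt] at hv h1 hi ⊢
      rw [hcw _ hv h1, hcw _ hv hi]
  have hGS : ContinuousOn G (uIcc x y) := hG.continuousOn.mono hxy
  have hfc : ContinuousOn (fun t => f (G t)) (uIcc x y) := by
    have hcov : uIcc x y = ⋃ i, uIcc x y ∩ G ⁻¹' (h i '' Icc 0 1) := by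
      refine Subset.antisymm (fun t ht => mem_iUnion.2 ⟨_, ht, hσ t ht⟩) ?_
      exact iUnion_subset fun i => inter_subset_left
    rw [hcov]
    refine (locallyFinite_of_finite _).continuousOn_iUnion (fun i => ?_) fun i => ?_
    · exact hGS.preimage_isClosed_of_isClosed isClosed_Icc
        (isCompact_Icc.image_of_continuousOn (hh i).continuousOn).isClosed
    · refine ContinuousOn.congr (f := fun t => Φ i (G t) - c i) ?_ fun t ht => hf t ht.1 i ht.2
      exact (((hh i).continuousOn_arcPrimitive (hg i) hp).comp (hGS.mono inter_subset_left)
        fun t ht => ht.2).sub continuousOn_const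
  -- Times at a vertex, where `G = w`, and times inside each arc. These sets may be very irregular,
  -- so only derivatives within them are used.
  let A : Option ι → Set ℝ := fun o => o.elim {t ∈ uIcc x y | G t ∈ arcVertices h}
    fun i => {t ∈ uIcc x y | G t ∈ h i '' Ioo 0 1}
  have key : f (G x) - lineIntegral p ℓ G a x = f (G y) - lineIntegral p ℓ G a y := by
    refine eq_of_hasDerivWithinAt_zero_iUnion (D := fun t => f (G t) - lineIntegral p ℓ G a t)
      (A := A) isPreconnected_uIcc
      (hfc.sub ((hG.continuousOn_lineIntegral hp).mono hxy)) ?_ ?_ left_mem_uIcc right_mem_uIcc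
    · intro t ht
      rw [mem_iUnion]
      by_cases hv : G t ∈ arcVertices h
      · exact ⟨none, ht, hv⟩
      · exact ⟨some (σ (G t)), ht, mem_image_Ioo_of_notMem_arcVertices hv (hσ t ht)⟩
    · rintro (_ | i) t ht
      · have hA : A none ⊆ Icc a b := fun s hs => hxy hs.1
        have hder := ((hG.hasDerivWithinAt_lineIntegral_of_const (ℓ := ℓ) hp hA
          (fun s hs => hw s hs.1 hs.2) ht).const_sub (f w))
        rw [neg_zero] at hder
        exact hder.congr (fun s hs => by rw [hw s hs.1 hs.2]) (by rw [hw t ht.1 ht.2])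
      · have hA : A (some i) ⊆ Icc a b := fun s hs => hxy hs.1
        have hder := (hG.hasDerivWithinAt_arcPrimitive_sub (ℓ := ℓ) (hh i) (hg i) (hg' i) hp hA
          (fun s hs => hs.2) ht).sub_const (c i)
        have hcongr : ∀ s ∈ A (some i), f (G s) - lineIntegral p ℓ G a s =
            arcPrimitive p ℓ (h i) (g i) (G s) - lineIntegral p ℓ G a s - c i := by
          intro s hs
          rw [hf s hs.1 i (image_mono Ioo_subset_Icc_self hs.2)]
          ring
        exact hder.congr hcongr (hcongr t ht)
  have hx := hxy left_mem_uIcc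
  have hy := hxy right_mem_uIcc
  have e1 := hG.lineIntegral_add (ℓ := ℓ) hp ⟨le_rfl, hx.1.trans hx.2⟩ hx hy
  change _ = f (G y) - f (G x)
  linarith

/-- The periods of `p dℓ` on closed paths in a triangulated curve lie in the group generated by the
values of the primitives along the arcs at the vertices. -/
theorem IsLipschitzPath.lineIntegral_mem_closure [Finite ι] (hG : IsLipschitzPath a b G)
    (hab : a ≤ b)
    (hh : ∀ i, IsLipschitzPath 0 1 (h i)) (hg : ∀ i, LeftInvOn (g i) (h i) (Icc 0 1))
    (hg' : ∀ i, LocallyLipschitzOn (h i '' Ioo 0 1) (g i)) (hp : Continuous p)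
    (hc : ∀ i j, i ≠ j → h i '' Icc 0 1 ∩ h j '' Icc 0 1 ⊆ {h i 0, h i 1} ∩ {h j 0, h j 1})
    (hGΓ : G '' Icc a b ⊆ ⋃ i, h i '' Icc 0 1) (hcl : G a = G b) :
    lineIntegral p ℓ G a b ∈ AddSubgroup.closure
      (⋃ i, {arcPrimitive p ℓ (h i) (g i) (h i 0), arcPrimitive p ℓ (h i) (g i) (h i 1)}) := by
  classical
  set Λ := AddSubgroup.closure
    (⋃ i, {arcPrimitive p ℓ (h i) (g i) (h i 0), arcPrimitive p ℓ (h i) (g i) (h i 1)}) with hΛ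
  obtain ⟨i₀, -⟩ := mem_iUnion.1 (hGΓ (mem_image_of_mem G (left_mem_Icc.2 hab)))
  let σ : E → ι := fun z => if hz : ∃ i, z ∈ h i '' Icc 0 1 then hz.choose else i₀
  have hσ : ∀ t ∈ Icc a b, G t ∈ h (σ (G t)) '' Icc 0 1 := by
    intro t ht
    have hz : ∃ i, G t ∈ h i '' Icc 0 1 := mem_iUnion.1 (hGΓ (mem_image_of_mem G ht))
    simp only [σ, dif_pos hz]
    exact hz.choose_spec
  let Φ : E → ℝ := fun z => arcPrimitive p ℓ (h (σ z)) (g (σ z)) z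
  -- `Φ` may jump at vertices, but this defect is additive over intervals, so membership in `Λ` need
  -- only be checked locally.
  suffices H : lineIntegral p ℓ G a b - (Φ (G b) - Φ (G a)) ∈ Λ by
    rwa [hcl, sub_self, sub_zero] at H
  refine isPreconnected_Icc.induction₂
    (P := fun x y => lineIntegral p ℓ G x y - (Φ (G y) - Φ (G x)) ∈ Λ) ?_ ?_ ?_
    (left_mem_Icc.2 hab) (right_mem_Icc.2 hab)
  · intro x hx
    have hfin : (arcVertices h \ {G x}).Finite :=
      (finite_iUnion fun i => (Set.toFinite _)).subset sdiff_subset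
    -- Vertices are finite in number, so near `x` the path meets none except possibly `G x`.
    have hnhds : ∀ᶠ t in 𝓝[Icc a b] x, G t ∈ (arcVertices h \ {G x})ᶜ :=
      (hG.continuousOn x hx) (hfin.isClosed.isOpen_compl.mem_nhds (by simp))
    obtain ⟨ε, hε, hball⟩ := Metric.mem_nhdsWithin_iff.1 hnhds
    filter_upwards [self_mem_nhdsWithin,
      mem_nhdsWithin_of_mem_nhds (Metric.ball_mem_nhds x hε)] with y hy hyε
    have hxy : uIcc x y ⊆ Icc a b := uIcc_subset_Icc hx hy
    have hxyε : uIcc x y ⊆ Metric.ball x ε :=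
      (convex_ball x ε).ordConnected.uIcc_subset (Metric.mem_ball_self hε) hyε
    obtain ⟨c, hcΛ, heq⟩ := hG.exists_lineIntegral_eq (ℓ := ℓ) hh hg hg' hp hc hxy (w := G x)
      (fun t ht hv => by
        by_contra hne
        exact hball ⟨hxyε ht, hxy ht⟩ ⟨hv, hne⟩) (fun t ht => hσ t (hxy ht))
    have hcmem : ∀ i, c i ∈ Λ := by
      intro i
      rcases hcΛ i with h0 | ⟨hv, hi, h1⟩
      · rw [h0]
        exact Λ.zero_mem
      · rw [h1]
        refine AddSubgroup.subset_closure (mem_iUnion.2 ⟨i, ?_⟩)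
        rcases mem_endpoints_of_mem_arcVertices hc hv hi with h2 | h2 <;> simp [h2]
    have : lineIntegral p ℓ G x y - (Φ (G y) - Φ (G x)) = c (σ (G x)) - c (σ (G y)) := by
      rw [heq]
      simp only [Φ]
      ring
    rw [this]
    exact Λ.sub_mem (hcmem _) (hcmem _)
  · intro x y z hx hy hz hxy hyz
    rw [← hG.lineIntegral_add hp hx hy hz]
    convert Λ.add_mem hxy hyz using 1
    ring
  · intro x y hx hy hxy
    convert Λ.neg_mem hxy using 1
    rw [lineIntegral, lineIntegral, intervalIntegral.integral_symm]
    ring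

end Triangulation

/-! ### Countability of the set of periods. -/

theorem AddSubgroup.countable_closure {A : Type*} [AddCommGroup A] {s : Set A}
    (hs : s.Countable) : ((AddSubgroup.closure s : AddSubgroup A) : Set A).Countable := by
  have := hs.to_subtype
  have h : Countable (Submodule.span ℤ (range ((↑) : s → A))) := inferInstance
  rw [Subtype.range_coe] at h
  rw [← Submodule.span_int_eq_addSubgroupClosure]
  exact h.to_set

/-- The line integrals of a `1`-form `p dℓ` over the closed Lipschitz paths in a triangulable curve
form a countable set. -/
theorem IsLipschitzTriangulable.exists_countable_lineIntegral_mem {E : Type*}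
    [NormedAddCommGroup E] [NormedSpace ℝ E] {Γ : Set E} (hΓ : IsLipschitzTriangulable Γ)
    {p : E → ℝ} (hp : Continuous p) (ℓ : E →L[ℝ] ℝ) :
    ∃ Λ : Set ℝ, Λ.Countable ∧ ∀ (a b : ℝ) (G : ℝ → E), a ≤ b → IsLipschitzPath a b G →
      G '' Icc a b ⊆ Γ → G a = G b → lineIntegral p ℓ G a b ∈ Λ := by
  obtain ⟨m, h, hh, rfl, hc⟩ := hΓ
  choose hh g hg hg' using hh
  exact ⟨_, AddSubgroup.countable_closure (countable_iUnion fun i => (Set.toFinite _).countable),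
    fun a b G hab hG hGΓ hcl => hG.lineIntegral_mem_closure hab hh hg hg' hp
      (fun i j hij => (hc i j hij).2) hGΓ hcl⟩

/-! ### Null sets of zeros of homogeneous forms. -/

/-- The zero set of a nonzero homogeneous analytic function is a null set. -/
theorem AnalyticOnNhd.ae_ne_zero_of_homogeneous {E : Type*} [NormedAddCommGroup E]
    [NormedSpace ℝ E] [FiniteDimensional ℝ E] [MeasurableSpace E] [BorelSpace E] {μ : Measure E}
    [μ.IsAddHaarMeasure] {φ : E → ℝ} (hφ : AnalyticOnNhd ℝ φ univ) {m : ℕ}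
    (hom : ∀ (t : ℝ) (x : E), φ (t • x) = t ^ m * φ x) {w : E} (hw : φ w ≠ 0) :
    ∀ᵐ x ∂μ, φ x ≠ 0 := by
  have hcont : Continuous φ := continuousOn_univ.1 hφ.continuousOn
  -- By Fubini, it is enough to treat each line parallel to `w`.
  refine ae_mem_of_ae_add_linearMap_mem (LinearMap.toSpanSingleton ℝ E w) volume μ
    (s := {x | φ x ≠ 0}) (isOpen_ne.preimage hcont).measurableSet fun y => ?_
  have han : AnalyticOnNhd ℝ (fun t : ℝ => φ (y + t • w)) univ := by
    refine fun t _ => AnalyticAt.fun_comp (hφ _ (mem_univ _)) ?_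
    fun_prop
  rcases han.eqOn_zero_or_eventually_ne_zero_of_preconnected isPreconnected_univ with h0 | h0
  · exfalso
    -- Homogeneity turns the far end of the line, `y + s⁻¹ • w`, into `s • y + w`, which tends to
    -- `w` as `s → 0`; so `φ` cannot vanish on the whole line.
    have hlim : ∀ᶠ s in 𝓝[≠] (0 : ℝ), φ (s • y + w) ≠ 0 := by
      have : ContinuousAt (fun s : ℝ => φ (s • y + w)) 0 := by fun_prop
      exact (this.eventually_ne (by simpa using hw)).filter_mono nhdsWithin_le_nhds
    obtain ⟨s, hs, hs0⟩ := (hlim.and self_mem_nhdsWithin).exists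
    refine hs ?_
    have hs0 : s ≠ 0 := hs0
    have e : s • y + w = s • (y + s⁻¹ • w) := by
      rw [smul_add, smul_smul, mul_inv_cancel₀ hs0, one_smul]
    rw [e, hom]
    simpa using Or.inr (h0 (mem_univ s⁻¹))
  · have := ae_restrict_le_codiscreteWithin (μ := (volume : Measure ℝ)) MeasurableSet.univ h0
    rw [Measure.restrict_univ] at this
    exact this

open Finset in
/-- The form `∑ multinomial(k) x^k y_i c_{k,i}`, in `(x, y)`, over multi-indices `k` of weight `d`
and indices `i`. If `c` consists of the moments of degree `d` of `G`, its value is the integral of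
`⟨x, G⟩ ^ d d⟨y, G⟩`. -/
noncomputable def momentForm {n : ℕ} (d : ℕ) (c : (Fin n → ℕ) → Fin n → ℝ)
    (v : EuclideanSpace ℝ (Fin n) × EuclideanSpace ℝ (Fin n)) : ℝ :=
  ∑ k ∈ piAntidiag univ d, ∑ i,
    (Nat.multinomial univ k : ℝ) * (∏ j, v.1 j ^ k j) * v.2 i * c k i

section MomentForm

variable {n : ℕ} {d : ℕ} {c : (Fin n → ℕ) → Fin n → ℝ}

theorem analyticOnNhd_momentForm : AnalyticOnNhd ℝ (momentForm d c) univ := by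
  have h1 : ∀ j : Fin n, AnalyticOnNhd ℝ
      (fun v : EuclideanSpace ℝ (Fin n) × EuclideanSpace ℝ (Fin n) => v.1 j) univ := fun j =>
    ((EuclideanSpace.proj j : EuclideanSpace ℝ (Fin n) →L[ℝ] ℝ).comp
      (ContinuousLinearMap.fst ℝ (EuclideanSpace ℝ (Fin n))
        (EuclideanSpace ℝ (Fin n)))).analyticOnNhd univ
  have h2 : ∀ j : Fin n, AnalyticOnNhd ℝ
      (fun v : EuclideanSpace ℝ (Fin n) × EuclideanSpace ℝ (Fin n) => v.2 j) univ := fun j =>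
    ((EuclideanSpace.proj j : EuclideanSpace ℝ (Fin n) →L[ℝ] ℝ).comp
      (ContinuousLinearMap.snd ℝ (EuclideanSpace ℝ (Fin n))
        (EuclideanSpace ℝ (Fin n)))).analyticOnNhd univ
  unfold momentForm
  refine Finset.analyticOnNhd_fun_sum _ fun k _ => Finset.analyticOnNhd_fun_sum _ fun i _ => ?_
  refine ((analyticOnNhd_const.mul ?_).mul (h2 i)).mul analyticOnNhd_const
  exact Finset.analyticOnNhd_fun_prod _ fun j _ => (h1 j).pow (k j)

theorem momentForm_smul (t : ℝ) (v : EuclideanSpace ℝ (Fin n) × EuclideanSpace ℝ (Fin n)) :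
    momentForm d c (t • v) = t ^ (d + 1) * momentForm d c v := by
  unfold momentForm
  rw [Finset.mul_sum]
  refine Finset.sum_congr rfl fun k hk => ?_
  rw [Finset.mul_sum]
  refine Finset.sum_congr rfl fun i _ => ?_
  have hk : ∑ j, k j = d := by simpa using hk
  simp only [Prod.smul_fst, Prod.smul_snd, PiLp.smul_apply, smul_eq_mul, mul_pow,
    Finset.prod_mul_distrib, Finset.prod_pow_eq_pow_sum, hk]
  ring

theorem eq_zero_of_momentForm_eq_zero (h : ∀ v, momentForm d c v = 0) {k : Fin n → ℕ}
    (hk : ∑ j, k j = d) (i : Fin n) : c k i = 0 := by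
  classical
  let P : MvPolynomial (Fin n) ℝ := ∑ k ∈ Finset.piAntidiag Finset.univ d,
    MvPolynomial.monomial (Finsupp.equivFunOnFinite.symm k)
      ((Nat.multinomial Finset.univ k : ℝ) * c k i)
  have hP : P = 0 := by
    refine MvPolynomial.funext fun x => ?_
    -- Taking the second vector to be the `i`-th basis vector isolates the coefficients `c k i`.
    rw [map_zero, ← h (WithLp.toLp 2 x, EuclideanSpace.single i 1)]
    simp only [P, map_sum, MvPolynomial.eval_monomial, momentForm]
    refine Finset.sum_congr rfl fun k _ => ?_
    rw [Finset.sum_eq_single i (fun j _ hj => by simp [hj]) (by simp),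
      Finsupp.prod_fintype _ _ (by simp)]
    simp
    ring
  have hcoeff := congrArg (MvPolynomial.coeff (Finsupp.equivFunOnFinite.symm k)) hP
  have hmem : k ∈ Finset.piAntidiag Finset.univ d := by simpa using hk
  simp only [P, MvPolynomial.coeff_sum, MvPolynomial.coeff_monomial, EmbeddingLike.apply_eq_iff_eq,
    Finset.sum_ite_eq', hmem, if_true, MvPolynomial.coeff_zero] at hcoeff
  exact (mul_eq_zero.1 hcoeff).resolve_left (by exact_mod_cast Nat.multinomial_pos _ _ |>.ne')

theorem ae_momentForm_ne_zero {k : Fin n → ℕ} (hk : ∑ j, k j = d) {i : Fin n} (hc : c k i ≠ 0) :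
    ∀ᵐ v : EuclideanSpace ℝ (Fin n) × EuclideanSpace ℝ (Fin n), momentForm d c v ≠ 0 := by
  have : ∃ w, momentForm d c w ≠ 0 := by
    by_contra! h
    exact hc (eq_zero_of_momentForm_eq_zero h hk i)
  obtain ⟨w, hw⟩ := this
  have : (volume : Measure (EuclideanSpace ℝ (Fin n) × EuclideanSpace ℝ (Fin n))).IsAddHaarMeasure :=
    Measure.prod.instIsAddHaarMeasure _ _
  exact analyticOnNhd_momentForm.ae_ne_zero_of_homogeneous momentForm_smul hw

end MomentForm

/-! ### Moments of paths and of their planar projections. -/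

section Moments

variable {n : ℕ} {a b : ℝ} {G : ℝ → EuclideanSpace ℝ (Fin n)}

/-- The restricted moments of the projection `G_v` are values of the form given by the moments of
`G`. -/
theorem IsLipschitzPath.integral_planarProj (hG : IsLipschitzPath a b G) (hab : a ≤ b) (d : ℕ)
    (v : EuclideanSpace ℝ (Fin n) × EuclideanSpace ℝ (Fin n)) :
    ∫ t in a..b, planarProj v G t 0 ^ d * deriv (fun s => planarProj v G s 1) t =
      momentForm d (moment a b G) v := by
  have hq : ∀ i, IsLipschitzPath a b fun s => G s i := fun i =>
    hG.clm_comp (EuclideanSpace.proj i)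
  -- Linearity of `deriv` needs all components differentiable, which holds almost everywhere.
  have hder : ∀ᵐ t, t ∈ uIcc a b →
      deriv (fun s => planarProj v G s 1) t = ∑ i, v.2 i * deriv (fun s => G s i) t := by
    have := ae_all_iff.2 fun i => ((hq i).absolutelyContinuousOnInterval (left_mem_Icc.2 hab)
      (right_mem_Icc.2 hab)).ae_differentiableAt
    filter_upwards [this] with t ht htab
    have hd := HasDerivAt.fun_sum (u := Finset.univ) fun i _ =>
      (ht i htab).hasDerivAt.const_mul (v.2 i)
    rw [← hd.deriv]
    congr 1
    ext s
    simp [planarProj, PiLp.inner_apply, mul_comm]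
  have hint : ∀ (k : Fin n → ℕ) (i : Fin n), IntervalIntegrable
      (fun t => (∏ j, G t j ^ k j) * deriv (fun s => G s i) t) volume a b := by
    intro k i
    refine (hq i).intervalIntegrable_mul_deriv ?_ (left_mem_Icc.2 hab) (right_mem_Icc.2 hab)
    exact continuousOn_finsetProd _ fun j _ => (hq j).continuousOn.pow _
  have heq : ∫ t in a..b, planarProj v G t 0 ^ d * deriv (fun s => planarProj v G s 1) t =
      ∫ t in a..b, ∑ k ∈ Finset.piAntidiag Finset.univ d, ∑ i,
        ((Nat.multinomial Finset.univ k : ℝ) * (∏ j, v.1 j ^ k j) * v.2 i) *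
          ((∏ j, G t j ^ k j) * deriv (fun s => G s i) t) := by
    refine intervalIntegral.integral_congr_ae ?_
    filter_upwards [hder] with t ht htab
    rw [ht (uIoc_subset_uIcc htab)]
    have h0 : planarProj v G t 0 = ∑ j, v.1 j * G t j := by
      simp [planarProj, PiLp.inner_apply, mul_comm]
    rw [h0, Finset.sum_pow_eq_sum_piAntidiag, Finset.sum_mul]
    refine Finset.sum_congr rfl fun k _ => ?_
    rw [Finset.mul_sum]
    refine Finset.sum_congr rfl fun i _ => ?_
    simp only [mul_pow, Finset.prod_mul_distrib]
    ring
  rw [heq, intervalIntegral.integral_finsetSum]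
  · unfold momentForm
    refine Finset.sum_congr rfl fun k _ => ?_
    rw [intervalIntegral.integral_finsetSum]
    · exact Finset.sum_congr rfl fun i _ => intervalIntegral.integral_const_mul _ _
    · exact fun i _ => (hint k i).const_mul _
  · intro k _
    simpa only [Finset.sum_fn] using IntervalIntegrable.sum Finset.univ fun i _ =>
      (hint k i).const_mul ((Nat.multinomial Finset.univ k : ℝ) * (∏ j, v.1 j ^ k j) * v.2 i)

end Moments

/-- For almost every `v`, for all closed paths `G` in a triangulable curve and all `d`, the
restricted moment of `G_v` of degree `d` vanishes only if all moments of `G` of degree `d` do. -/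
theorem IsLipschitzTriangulable.ae_moment_eq_zero {n : ℕ} {Γ : Set (EuclideanSpace ℝ (Fin n))}
    (hΓ : IsLipschitzTriangulable Γ) {a b : ℝ} (hab : a ≤ b) :
    ∀ᵐ v : EuclideanSpace ℝ (Fin n) × EuclideanSpace ℝ (Fin n),
      ∀ G : ℝ → EuclideanSpace ℝ (Fin n), IsLipschitzPath a b G → G '' Icc a b ⊆ Γ → G a = G b →
        ∀ d : ℕ, momentForm d (moment a b G) v = 0 →
          ∀ (k : Fin n → ℕ) (i : Fin n), ∑ j, k j = d → moment a b G k i = 0 := by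
  choose Λ hΛ hmem using fun (k : Fin n → ℕ) (i : Fin n) =>
    hΓ.exists_countable_lineIntegral_mem (p := fun x => ∏ j, x j ^ k j) (by fun_prop)
      (EuclideanSpace.proj i)
  have hdeg : ∀ d : ℕ, ∀ᵐ v : EuclideanSpace ℝ (Fin n) × EuclideanSpace ℝ (Fin n),
      ∀ G : ℝ → EuclideanSpace ℝ (Fin n), IsLipschitzPath a b G → G '' Icc a b ⊆ Γ → G a = G b →
        momentForm d (moment a b G) v = 0 →
          ∀ (k : Fin n → ℕ) (i : Fin n), ∑ j, k j = d → moment a b G k i = 0 := by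
    intro d
    let T := Finset.piAntidiag (Finset.univ : Finset (Fin n)) d
    -- Only finitely many multi-indices have weight `d`; a finite index type keeps the set of
    -- candidate coefficient families countable.
    let ext : (T × Fin n → ℝ) → (Fin n → ℕ) → Fin n → ℝ := fun c k i =>
      if hk : k ∈ T then c (⟨k, hk⟩, i) else 0
    have hC : {c : T × Fin n → ℝ | ∀ q, c q ∈ Λ q.1 q.2}.Countable :=
      countable_pi fun q => hΛ q.1 q.2
    have hae : ∀ᵐ v : EuclideanSpace ℝ (Fin n) × EuclideanSpace ℝ (Fin n),
        ∀ c ∈ {c : T × Fin n → ℝ | ∀ q, c q ∈ Λ q.1 q.2}, momentForm d (ext c) v = 0 →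
          ∀ (k : Fin n → ℕ) (i : Fin n), ∑ j, k j = d → ext c k i = 0 := by
      -- Countability of the candidates lets "almost every `v`" be moved outside "for all `c`".
      refine (ae_ball_iff hC).2 fun c _ => ?_
      by_cases hz : ∃ (k : Fin n → ℕ) (i : Fin n), ∑ j, k j = d ∧ ext c k i ≠ 0
      · obtain ⟨k, i, hk, hki⟩ := hz
        filter_upwards [ae_momentForm_ne_zero hk hki] with v hv h0
        exact absurd h0 hv
      · push Not at hz
        exact Eventually.of_forall fun v _ => hz
    filter_upwards [hae] with v hv G hG hGΓ hcl h0
    have hext : ∀ (k : Fin n → ℕ) (i : Fin n), k ∈ T →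
        ext (fun q => moment a b G q.1 q.2) k i = moment a b G k i := by
      intro k i hk
      simp only [ext, dif_pos hk]
    intro k i hk
    rw [← hext k i (by simpa [T] using hk)]
    refine hv (fun q => moment a b G q.1 q.2) (fun q => hmem _ _ a b G hab hG hGΓ hcl) ?_ k i hk
    rw [← h0]
    unfold momentForm
    exact Finset.sum_congr rfl fun k hk => Finset.sum_congr rfl fun i _ => by rw [hext k i hk]
  filter_upwards [ae_all_iff.2 hdeg] with v hv G hG hGΓ hcl d using hv d G hG hGΓ hcl

theorem theorem3p1 (n : ℕ) (hn : 3 ≤ n) (a b : ℝ) (hab : a < b)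
    (F : ℝ → EuclideanSpace ℝ (Fin n)) (hF : IsLipschitzPath a b F)
    (hFnc : ∃ s ∈ Icc a b, ∃ t ∈ Icc a b, F s ≠ F t)
    (hΓ : IsLipschitzTriangulable (F '' Icc a b))
    (H : Set (ℝ → EuclideanSpace ℝ (Fin n))) (hH : H ⊆ lipschitzMapsInto a b F)
    (hclosed : ∀ G ∈ H, G a = G b) :
    ∀ᵐ v : EuclideanSpace ℝ (Fin n) × EuclideanSpace ℝ (Fin n) ∂volume,
      ((∃ N : ℕ, MomentsFiniteness a b H N) ↔
        ∃ N : ℕ, RestrictedMomentsFiniteness a b (planarProj v '' H) N) ∧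
      ∀ N : ℕ, IsLeast {N | MomentsFiniteness a b H N} N ↔
        IsLeast {N | RestrictedMomentsFiniteness a b (planarProj v '' H) N} N := by
  filter_upwards [hΓ.ae_moment_eq_zero hab.le] with v hv
  have hvanish : ∀ G ∈ H, ∀ d : ℕ,
      (∫ t in a..b, planarProj v G t 0 ^ d * deriv (fun s => planarProj v G s 1) t) = 0 ↔
        ∀ (k : Fin n → ℕ) (i : Fin n), ∑ j, k j = d → moment a b G k i = 0 := by
    intro G hG d
    obtain ⟨hGL, hGΓ⟩ := hH hG
    rw [hGL.integral_planarProj hab.le]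
    refine ⟨hv G hGL hGΓ (hclosed G hG) d, fun h => ?_⟩
    unfold momentForm
    refine Finset.sum_eq_zero fun k hk => Finset.sum_eq_zero fun i _ => ?_
    rw [h k i (by simpa using hk), mul_zero]
  -- The extra condition of the restricted problem is automatic for closed paths.
  have hfirst : ∀ G ∈ H, (∫ t in a..b, deriv (fun s => planarProj v G s 0) t) = 0 := by
    intro G hG
    obtain ⟨hGL, -⟩ := hH hG
    have : IsLipschitzPath a b fun s => planarProj v G s 0 := by
      simpa [planarProj] using hGL.clm_comp (innerSL ℝ v.1)
    rw [(this.absolutelyContinuousOnInterval (left_mem_Icc.2 hab.le)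
      (right_mem_Icc.2 hab.le)).integral_deriv_eq_sub]
    simp [planarProj, hclosed G hG]
  have key : ∀ N, MomentsFiniteness a b H N ↔
      RestrictedMomentsFiniteness a b (planarProj v '' H) N := by
    intro N
    constructor
    · rintro h _ ⟨G, hG, rfl⟩ - hN d
      refine (hvanish G hG d).2 fun k i _ => h G hG (fun k i hk => ?_) k i
      exact (hvanish G hG _).1 (hN _ hk) k i rfl
    · intro h G hG hN k i
      refine (hvanish G hG _).1 (h _ (mem_image_of_mem _ hG) (hfirst G hG) (fun d hd => ?_) _)
        k i rfl
      exact (hvanish G hG d).2 fun k i hk => hN k i (hk.le.trans hd)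
  simp only [key, implies_true, and_self]
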